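/- Let Sylvester's sequence be $s_1=2$, $s_{m+1}=s_m^2-s_m+1$, and call a prime a Sylvester prime if it divides some $s_m$. For a finite connected simple graph $G$ with adjacency matrix $A(G)$, an arithmetical structure on $G$ is a pair $(\mathbf d,\mathbf r)$ of labelings of the vertices of $G$ by nonnegative integers $d_v$ and positive integers $r_v$ such that the $r_v$ have no common factor greater than $1$ and $r_vd_v=\sum_{u\text{ adjacent to }v}r_u$ for every vertex $v$; its critical group is the torsion subgroup of the cokernel of $\operatorname{diag}(\mathbf d)-A(G)$ acting on $\mathbb Z^{V(G)}$. Let $S_n$ be the star graph with $n$ leaves and $K_n$ the complete graph on $n$ vertices. If $c=\prod_i p_i$ is a finite (possibly empty) product of distinct Sylvester primes $p_i$, then there is an $n\ge 1$ such that $\mathbb Z/c\mathbb Z$ is isomorphic to the critical group of some arithmetical structure on $S_n$ and to the critical group of some arithmetical structure on $K_n$. Moreover, there are infinitely many positive integers $c$ for which there is an $n\geq 1$ such that $\mathbb Z/c\mathbb Z$ is isomorphic to the critical group of an arithmetical structure on $S_n$ and to that of an arithmetical structure on $K_n$. -/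

import Mathlib

/-- An arithmetical structure on a finite simple graph `G` (taken to be connected): a labeling of
the vertices by nonnegative integers `d` and positive integers `r`, the latter without common
factor, such that `r v * d v` is the sum of `r u` over the neighbors `u` of `v`, for every `v`. -/
@[ext]
structure ArithmeticalStructure {V : Type*} [Fintype V] (G : SimpleGraph V)
    [DecidableRel G.Adj] where
  d : V → ℕ
  r : V → ℕ
  r_pos : ∀ v, 0 < r v
  r_mul_d : ∀ v, r v * d v = ∑ u ∈ G.neighborFinset v, r u
  gcd_r : Finset.univ.gcd r = 1

namespace ArithmeticalStructure

variable {V : Type*} [Fintype V] [DecidableEq V] {G : SimpleGraph V} [DecidableRel G.Adj]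

/-- The matrix `L(G, d) = diag(d) - A(G)`. -/
def matrix (S : ArithmeticalStructure G) : Matrix V V ℤ :=
  Matrix.diagonal (fun v => (S.d v : ℤ)) - G.adjMatrix ℤ

/-- The cokernel of `L(G, d)`, viewed as a linear map `ℤ^V → ℤ^V`. -/
abbrev Cokernel (S : ArithmeticalStructure G) : Type _ :=
  (V → ℤ) ⧸ LinearMap.range S.matrix.mulVecLin

/-- The critical group: the torsion part of the cokernel of `L(G, d)`. -/
abbrev CriticalGroup (S : ArithmeticalStructure G) : Type _ :=
  Submodule.torsion ℤ S.Cokernel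

end ArithmeticalStructure

/-- The star graph `S_n`: `n` leaves `1, …, n` joined to the central vertex `0`. -/
abbrev starWithLeaves (n : ℕ) : SimpleGraph (Fin (n + 1)) :=
  SimpleGraph.starGraph 0

/-- Sylvester's sequence `2, 3, 7, 43, 1807, …`, indexed from `0`; the natural-number subtraction
does not truncate, since `s ≤ s ^ 2`. -/
def sylvesterSeq : ℕ → ℕ
  | 0 => 2
  | n + 1 => sylvesterSeq n ^ 2 - sylvesterSeq n + 1

/-- A Sylvester prime is a prime that divides some term of Sylvester's sequence. -/
def IsSylvesterPrime (p : ℕ) : Prop :=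
  p.Prime ∧ ∃ m, p ∣ sylvesterSeq m

/-- The group `ℤ/cℤ` is (isomorphic to) the critical group of some arithmetical structure
on `G`. -/
def IsCyclicCriticalGroup {V : Type*} [Fintype V] [DecidableEq V] (G : SimpleGraph V)
    [DecidableRel G.Adj] (c : ℕ) : Prop :=
  ∃ S : ArithmeticalStructure G, Nonempty (S.CriticalGroup ≃+ ZMod c)

/-!
Suppose `∑ 1 / dᵢ = 1` with `n` terms. The star with leaf labels `dᵢ` and central label `1`, and the
complete graph with labels `dᵢ - 1`, both carry arithmetical structures, with `rᵢ = L / dᵢ` for a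
common multiple `L` of the `dᵢ` (and `r = L` at the centre of the star). In both cases solving the
linear system shows that an integer vector `v` lies in the image of `diag(d) - A` iff `⟨r, v⟩ = 0`
and there is an integer `s` with `dᵢ ∣ vᵢ + s` for all `i` running over the `n` denominators. Hence
the two critical groups agree, and they are cyclic of order `c` as soon as the solvability of these
congruences is measured by one linear form with values in `ℤ/c`; this is packaged in
`UnitFractionCertificate`.

Let now `N = s₁ ⋯ sₘ = sₘ₊₁ - 1` and let `N = c K` be any factorization. Then
`1 = 1/s₁ + ⋯ + 1/sₘ + 1/N` and `1/N = 1/(c(K+1)) + 1/(N(K+1))`. The `sᵢ` are pairwise coprime, so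
the congruences modulo the `sᵢ` amount to a single one modulo `N`; it is compatible with the one
modulo `c(K+1)` precisely when the two agree modulo `gcd(cK, c(K+1)) = c`, and the congruence modulo
`N(K+1)` is then automatic because `⟨r, v⟩ = 0`. So every divisor `c` of every `sₘ₊₁ - 1` occurs
(`exists_cyclicCriticalGroup_of_dvd`). A finite product of distinct Sylvester primes divides
`sₘ₊₁ - 1` for all large `m`, and the numbers `sₘ₊₁ - 1` themselves are infinitely many.
-/

section CyclicTorsion

/-- If a submodule `P` is cut out by an integer-valued linear form `f` and a `ℤ/c`-valued one `g`,
and `g` is onto already on the kernel of `f`, then the torsion of the quotient by `P` is `ℤ/c`. -/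
theorem nonempty_torsion_quotient_addEquiv_zmod {E : Type*} [AddCommGroup E] {c : ℕ} (hc : 0 < c)
    (P : Submodule ℤ E) (f : E →ₗ[ℤ] ℤ) (g : E →ₗ[ℤ] ZMod c)
    (hP : ∀ v, v ∈ P ↔ f v = 0 ∧ g v = 0) (hu : ∃ u, f u = 0 ∧ g u = 1) :
    Nonempty (Submodule.torsion ℤ (E ⧸ P) ≃+ ZMod c) := by
  obtain ⟨u, hfu, hgu⟩ := hu
  let gbar : (E ⧸ P) →ₗ[ℤ] ZMod c := P.liftQ g fun v hv => ((hP v).1 hv).2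
  let φ : Submodule.torsion ℤ (E ⧸ P) →ₗ[ℤ] ZMod c := gbar ∘ₗ Submodule.subtype _
  refine ⟨AddEquiv.ofBijective φ.toAddMonoidHom ⟨?_, ?_⟩⟩
  · refine (injective_iff_map_eq_zero φ).2 ?_
    rintro ⟨x, hx⟩ hφ
    obtain ⟨v, rfl⟩ := P.mkQ_surjective x
    obtain ⟨a, ha⟩ := (Submodule.mem_torsion_iff _).1 hx
    have ha' : (a : ℤ) • v ∈ P := by
      rw [← Submodule.Quotient.mk_eq_zero P]
      exact ha
    have h0 : (a : ℤ) * f v = 0 := by simpa using ((hP _).1 ha').1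
    have hf : f v = 0 := (mul_eq_zero.1 h0).resolve_left (nonZeroDivisors.ne_zero a.2)
    have hg : g v = 0 := hφ
    ext
    exact (Submodule.Quotient.mk_eq_zero P).2 ((hP v).2 ⟨hf, hg⟩)
  · intro z
    obtain ⟨k, rfl⟩ := ZMod.intCast_surjective z
    refine ⟨⟨P.mkQ (k • u), (Submodule.mem_torsion_iff _).2
      ⟨⟨(c : ℤ), mem_nonZeroDivisors_of_ne_zero (by exact_mod_cast hc.ne')⟩, ?_⟩⟩, ?_⟩
    · change (c : ℤ) • P.mkQ (k • u) = 0
      rw [← map_smul]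
      refine (Submodule.Quotient.mk_eq_zero P).2 ((hP _).2 ⟨by simp [hfu], by simp⟩)
    · change g (k • u) = (k : ZMod c)
      simp [hgu]

end CyclicTorsion

/-! ### Unit fractions and critical groups -/

/-- A representation `1 = ∑ 1 / d i` with common denominator `L` and numerators `r i = L / d i`,
together with integer weights `w` for which `∑ w i * v i` modulo `c` is the exact obstruction, for
`v` with `∑ r i * v i` divisible by `L`, to finding `s` with `d i ∣ v i + s` for all `i`. -/
structure UnitFractionCertificate (n c : ℕ) where
  d : Fin n → ℕ
  r : Fin n → ℕ
  L : ℕ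
  w : Fin n → ℤ
  r_pos : ∀ i, 0 < r i
  L_pos : 0 < L
  gcd_r : Finset.univ.gcd r = 1
  r_mul_d : ∀ i, r i * d i = L
  sum_r : ∑ i, r i = L
  sum_w : ∑ i, w i = 0
  dvd_w_mul_d : ∀ i, (c : ℤ) ∣ w i * d i
  exists_shift : ∀ v : Fin n → ℤ, (L : ℤ) ∣ ∑ i, r i * v i → (c : ℤ) ∣ ∑ i, w i * v i →
    ∃ s : ℤ, ∀ i, (d i : ℤ) ∣ v i + s
  exists_generator : ∃ u : Fin n → ℤ, ∑ i, r i * u i = 0 ∧ ∑ i, w i * u i = 1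

namespace UnitFractionCertificate

variable {n c : ℕ} (C : UnitFractionCertificate n c)

theorem d_pos (i : Fin n) : 0 < C.d i :=
  Nat.pos_of_ne_zero fun h => C.L_pos.ne' (by rw [← C.r_mul_d i, h, mul_zero])

theorem dvd_sum_w_mul {v : Fin n → ℤ} {s : ℤ} (h : ∀ i, (C.d i : ℤ) ∣ v i + s) :
    (c : ℤ) ∣ ∑ i, C.w i * v i := by
  have : ∑ i, C.w i * v i = ∑ i, C.w i * (v i + s) := by
    simp only [mul_add, Finset.sum_add_distrib, ← Finset.sum_mul, C.sum_w, zero_mul, add_zero]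
  rw [this]
  exact Finset.dvd_sum fun i _ => (C.dvd_w_mul_d i).trans (mul_dvd_mul_left _ (h i))

theorem L_mul_sum_eq {v y : Fin n → ℤ} {s : ℤ} (h : ∀ i, v i + s = C.d i * y i) :
    C.L * ∑ i, y i = ∑ i, C.r i * v i + C.L * s := by
  have hs : (C.L : ℤ) * s = ∑ i, (C.r i : ℤ) * s := by
    rw [← Finset.sum_mul, ← C.sum_r]; push_cast; rfl
  rw [hs, ← Finset.sum_add_distrib, Finset.mul_sum]
  refine Finset.sum_congr rfl fun i _ => ?_
  rw [← mul_add, h i, ← mul_assoc, ← C.r_mul_d i]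
  push_cast; rfl

/-- The arithmetical structure on the complete graph with `d`-labels one less than the
denominators. -/
def complete : ArithmeticalStructure (⊤ : SimpleGraph (Fin n)) where
  d i := C.d i - 1
  r := C.r
  r_pos := C.r_pos
  gcd_r := C.gcd_r
  r_mul_d i := by
    have h : (⊤ : SimpleGraph (Fin n)).neighborFinset i = Finset.univ.erase i := by
      ext j; simp [eq_comm]
    have h2 := Finset.add_sum_erase Finset.univ C.r (Finset.mem_univ i)
    have h3 := C.r_mul_d i
    rw [C.sum_r] at h2
    rw [h, Nat.mul_sub, mul_one]
    omega

theorem complete_mulVec (y : Fin n → ℤ) (i : Fin n) :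
    (C.complete.matrix.mulVec y) i = C.d i * y i - ∑ j, y j := by
  have h : (⊤ : SimpleGraph (Fin n)).neighborFinset i = Finset.univ.erase i := by
    ext j; simp [eq_comm]
  have h2 := Finset.add_sum_erase Finset.univ y (Finset.mem_univ i)
  rw [ArithmeticalStructure.matrix, Matrix.sub_mulVec, Pi.sub_apply, Matrix.mulVec_diagonal,
    SimpleGraph.adjMatrix_mulVec_apply, h, ← h2]
  have : ((C.complete.d i : ℕ) : ℤ) = C.d i - 1 := by
    have := C.d_pos i
    simp only [complete]
    omega
  rw [this]; ring

theorem complete_mem_range_iff (v : Fin n → ℤ) :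
    v ∈ LinearMap.range C.complete.matrix.mulVecLin ↔
      ∑ i, C.r i * v i = 0 ∧ (c : ℤ) ∣ ∑ i, C.w i * v i := by
  constructor
  · rintro ⟨y, rfl⟩
    have h : ∀ i, C.complete.matrix.mulVecLin y i + ∑ j, y j = C.d i * y i := fun i => by
      rw [Matrix.mulVecLin_apply, complete_mulVec]; ring
    exact ⟨by linarith [C.L_mul_sum_eq h], C.dvd_sum_w_mul fun i => ⟨_, h i⟩⟩
  · rintro ⟨hr, hw⟩
    obtain ⟨s, hs⟩ := C.exists_shift v (hr ▸ dvd_zero _) hw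
    choose y hy using hs
    refine ⟨y, funext fun i => ?_⟩
    have h1 := C.L_mul_sum_eq hy
    rw [hr, zero_add] at h1
    rw [Matrix.mulVecLin_apply, complete_mulVec,
      mul_left_cancel₀ (by exact_mod_cast C.L_pos.ne') h1, ← hy i]
    ring

theorem isCyclicCriticalGroup_complete (C : UnitFractionCertificate n c) (hc : 0 < c) :
    IsCyclicCriticalGroup (⊤ : SimpleGraph (Fin n)) c := by
  obtain ⟨u, hu1, hu2⟩ := C.exists_generator
  let f : (Fin n → ℤ) →ₗ[ℤ] ℤ := Fintype.linearCombination ℤ fun i => (C.r i : ℤ)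
  let g : (Fin n → ℤ) →ₗ[ℤ] ℤ := Fintype.linearCombination ℤ C.w
  have hf : ∀ v, f v = ∑ i, C.r i * v i := fun v => by
    simp [f, Fintype.linearCombination_apply, mul_comm]
  have hg : ∀ v, g v = ∑ i, C.w i * v i := fun v => by
    simp [g, Fintype.linearCombination_apply, mul_comm]
  refine ⟨C.complete, nonempty_torsion_quotient_addEquiv_zmod hc _ f
    ((Int.castAddHom (ZMod c)).toIntLinearMap ∘ₗ g) (fun v => ?_) ⟨u, ?_, ?_⟩⟩
  · rw [complete_mem_range_iff, hf, ← hg, ← ZMod.intCast_zmod_eq_zero_iff_dvd]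
    rfl
  · rw [hf, hu1]
  · change ((g u : ℤ) : ZMod c) = 1
    rw [hg, hu2, Int.cast_one]

theorem neighborFinset_starWithLeaves_zero :
    (starWithLeaves n).neighborFinset 0 = Finset.univ.map (Fin.succEmb n) := by
  ext j
  cases j using Fin.cases <;> simp [SimpleGraph.starGraph_adj, (Fin.succ_ne_zero _).symm]

theorem neighborFinset_starWithLeaves_succ (i : Fin n) :
    (starWithLeaves n).neighborFinset i.succ = {0} := by
  ext j
  cases j using Fin.cases <;> simp [SimpleGraph.starGraph_adj]

/-- The arithmetical structure on the star with central `d`-label `1` and leaf labels the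
denominators. -/
def star : ArithmeticalStructure (starWithLeaves n) where
  d := Fin.cons 1 C.d
  r := Fin.cons C.L C.r
  r_pos i := by
    cases i using Fin.cases with
    | zero => exact C.L_pos
    | succ i => exact C.r_pos i
  gcd_r := by
    refine Nat.dvd_one.1 (dvd_trans (Finset.dvd_gcd fun i _ => ?_) C.gcd_r.dvd)
    simpa using Finset.gcd_dvd (f := (Fin.cons C.L C.r : Fin (n + 1) → ℕ))
      (Finset.mem_univ i.succ)
  r_mul_d i := by
    cases i using Fin.cases with
    | zero => simp [neighborFinset_starWithLeaves_zero, C.sum_r]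
    | succ i => simp [neighborFinset_starWithLeaves_succ, C.r_mul_d]

theorem star_mulVec_zero (y : Fin (n + 1) → ℤ) :
    (C.star.matrix.mulVec y) 0 = y 0 - ∑ i : Fin n, y i.succ := by
  rw [ArithmeticalStructure.matrix, Matrix.sub_mulVec, Pi.sub_apply, Matrix.mulVec_diagonal,
    SimpleGraph.adjMatrix_mulVec_apply, neighborFinset_starWithLeaves_zero]
  simp [star]

theorem star_mulVec_succ (y : Fin (n + 1) → ℤ) (i : Fin n) :
    (C.star.matrix.mulVec y) i.succ = C.d i * y i.succ - y 0 := by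
  rw [ArithmeticalStructure.matrix, Matrix.sub_mulVec, Pi.sub_apply, Matrix.mulVec_diagonal,
    SimpleGraph.adjMatrix_mulVec_apply, neighborFinset_starWithLeaves_succ]
  simp [star]

theorem star_mem_range_iff (v : Fin (n + 1) → ℤ) :
    v ∈ LinearMap.range C.star.matrix.mulVecLin ↔
      C.L * v 0 + ∑ i : Fin n, C.r i * v i.succ = 0 ∧
        (c : ℤ) ∣ ∑ i : Fin n, C.w i * v i.succ := by
  constructor
  · rintro ⟨y, rfl⟩
    have h : ∀ i : Fin n, C.star.matrix.mulVecLin y i.succ + y 0 = C.d i * y i.succ := fun i => by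
      rw [Matrix.mulVecLin_apply, star_mulVec_succ]; ring
    refine ⟨?_, C.dvd_sum_w_mul fun i => ⟨_, h i⟩⟩
    have h1 := C.L_mul_sum_eq h
    have h0 : C.star.matrix.mulVecLin y 0 = y 0 - ∑ i : Fin n, y i.succ := C.star_mulVec_zero y
    rw [h0]
    linarith
  · rintro ⟨hr, hw⟩
    obtain ⟨s, hs⟩ := C.exists_shift (fun i => v i.succ) ⟨-v 0, by linarith⟩ hw
    choose y hy using hs
    have h1 : s - ∑ i, y i = v 0 := by
      refine mul_left_cancel₀ (a := (C.L : ℤ)) (by exact_mod_cast C.L_pos.ne') ?_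
      linarith [C.L_mul_sum_eq hy]
    refine ⟨Fin.cons s y, funext fun i => ?_⟩
    rw [Matrix.mulVecLin_apply]
    cases i using Fin.cases with
    | zero => rw [star_mulVec_zero, ← h1]; simp
    | succ i =>
      rw [star_mulVec_succ]
      simp only [Fin.cons_succ, Fin.cons_zero]
      linarith [hy i]

theorem isCyclicCriticalGroup_star (C : UnitFractionCertificate n c) (hc : 0 < c) :
    IsCyclicCriticalGroup (starWithLeaves n) c := by
  obtain ⟨u, hu1, hu2⟩ := C.exists_generator
  let f : (Fin (n + 1) → ℤ) →ₗ[ℤ] ℤ :=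
    Fintype.linearCombination ℤ (Fin.cons (C.L : ℤ) fun i => (C.r i : ℤ))
  let g : (Fin (n + 1) → ℤ) →ₗ[ℤ] ℤ := Fintype.linearCombination ℤ (Fin.cons 0 C.w)
  have hf : ∀ v, f v = C.L * v 0 + ∑ i : Fin n, C.r i * v i.succ := fun v => by
    simp [f, Fintype.linearCombination_apply, Fin.sum_univ_succ, mul_comm]
  have hg : ∀ v, g v = ∑ i : Fin n, C.w i * v i.succ := fun v => by
    simp [g, Fintype.linearCombination_apply, Fin.sum_univ_succ, mul_comm]
  refine ⟨C.star, nonempty_torsion_quotient_addEquiv_zmod hc _ f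
    ((Int.castAddHom (ZMod c)).toIntLinearMap ∘ₗ g) (fun v => ?_) ⟨Fin.cons 0 u, ?_, ?_⟩⟩
  · rw [star_mem_range_iff, hf, ← hg, ← ZMod.intCast_zmod_eq_zero_iff_dvd]
    rfl
  · rw [hf]; simpa using hu1
  · change ((g (Fin.cons 0 u) : ℤ) : ZMod c) = 1
    rw [hg]
    simp only [Fin.cons_succ]
    rw [hu2, Int.cast_one]

end UnitFractionCertificate

/-! ### Products of Sylvester numbers -/

theorem prod_sylvesterSeq_add_one (m : ℕ) :
    ∏ i ∈ Finset.range m, sylvesterSeq i + 1 = sylvesterSeq m := by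
  induction m with
  | zero => rfl
  | succ m ih =>
    rw [Finset.prod_range_succ, sylvesterSeq, ← ih]
    congr 1
    rw [pow_two, ← Nat.sub_one_mul, Nat.add_sub_cancel]

theorem prod_sylvesterSeq_pos (m : ℕ) : 0 < ∏ i ∈ Finset.range m, sylvesterSeq i :=
  Finset.prod_pos fun i _ => by rw [← prod_sylvesterSeq_add_one]; exact Nat.succ_pos _

theorem sylvesterSeq_pos (m : ℕ) : 0 < sylvesterSeq m := by
  rw [← prod_sylvesterSeq_add_one]; exact Nat.succ_pos _

theorem sylvesterSeq_dvd_prod {i m : ℕ} (h : i < m) :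
    sylvesterSeq i ∣ ∏ j ∈ Finset.range m, sylvesterSeq j :=
  Finset.dvd_prod_of_mem _ (Finset.mem_range.2 h)

theorem coprime_sylvesterSeq_of_lt {i j : ℕ} (h : i < j) :
    (sylvesterSeq i).Coprime (sylvesterSeq j) := by
  obtain ⟨k, hk⟩ := sylvesterSeq_dvd_prod h
  rw [← prod_sylvesterSeq_add_one j, hk]
  simp

theorem coprime_sylvesterSeq {i j : ℕ} (h : i ≠ j) :
    (sylvesterSeq i).Coprime (sylvesterSeq j) :=
  h.lt_or_gt.elim coprime_sylvesterSeq_of_lt fun h => (coprime_sylvesterSeq_of_lt h).symm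

/-- With `N` the product of the first `m` Sylvester numbers, the sum of their reciprocals is
`1 - 1 / N`. -/
theorem sum_prod_div_sylvesterSeq_add_one (m : ℕ) :
    ∑ i ∈ Finset.range m, (∏ j ∈ Finset.range m, sylvesterSeq j) / sylvesterSeq i + 1 =
      ∏ j ∈ Finset.range m, sylvesterSeq j := by
  induction m with
  | zero => rfl
  | succ m ih =>
    rw [Finset.sum_range_succ, Finset.prod_range_succ, Nat.mul_div_cancel _ (sylvesterSeq_pos m)]
    rw [Finset.sum_congr rfl fun i hi => Nat.mul_div_right_comm
      (sylvesterSeq_dvd_prod (Finset.mem_range.1 hi)) (sylvesterSeq m), ← Finset.sum_mul]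
    have h := prod_sylvesterSeq_add_one m
    set N := ∏ j ∈ Finset.range m, sylvesterSeq j
    rw [add_assoc, h, ← Nat.succ_mul, Nat.succ_eq_add_one, ih]

/-- Bézout weights: they are the idempotents of the decomposition of `ℤ / N` into the product of
the `ℤ / sylvesterSeq i`, where `N` is the product of the first `m + 1` Sylvester numbers. -/
theorem exists_sylvesterSeq_weights (m : ℕ) :
    ∃ W : ℕ → ℤ, ∑ i ∈ Finset.range (m + 1), W i = 1 ∧ ∀ i ∈ Finset.range (m + 1),
      ((∏ j ∈ Finset.range (m + 1), sylvesterSeq j : ℕ) : ℤ) ∣ W i * sylvesterSeq i := by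
  obtain ⟨μ, hμ⟩ := (exists_sum_eq_one_iff_pairwise_coprime
    (s := fun i => (sylvesterSeq i : ℤ)) (Finset.nonempty_range_add_one (n := m))).2
    fun i j hij => Nat.isCoprime_iff_coprime.2
      (coprime_sylvesterSeq fun h => hij (Subtype.ext h))
  refine ⟨_, hμ, fun i hi => ⟨μ i, ?_⟩⟩
  push_cast
  rw [← Finset.prod_sdiff (Finset.singleton_subset_iff.2 hi), Finset.prod_singleton]
  ring

/-- The certificate of the representation of `1` by the reciprocals of the first `m + 1` Sylvester
numbers, of `c * (K + 1)` and of `c * K * (K + 1)`, where `c * K` is the product of these Sylvester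
numbers. The last denominator has index `0` and `c * (K + 1)` has index `1`. -/
theorem nonempty_sylvester_certificate (m c K : ℕ)
    (hN : ∏ i ∈ Finset.range (m + 1), sylvesterSeq i = c * K) :
    Nonempty (UnitFractionCertificate (m + 3) c) := by
  obtain ⟨W, hW1, hW⟩ := exists_sylvesterSeq_weights m
  have hsum := sum_prod_div_sylvesterSeq_add_one (m + 1)
  have hpos := prod_sylvesterSeq_pos (m + 1)
  have hdvd : ∀ i : Fin (m + 1), sylvesterSeq i ∣ c * K := fun i => hN ▸ sylvesterSeq_dvd_prod i.2
  simp only [hN] at hW hsum hpos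
  rw [Finset.sum_range] at hsum hW1
  have hdvd' : ∀ i : Fin (m + 1), c * K / sylvesterSeq i * sylvesterSeq i = c * K :=
    fun i => Nat.div_mul_cancel (hdvd i)
  have hKpos : 0 < K := Nat.pos_of_mul_pos_left hpos
  have hWi : ∀ i : Fin (m + 1), ((c * K : ℕ) : ℤ) ∣ W i * sylvesterSeq i :=
    fun i => hW i (Finset.mem_range.2 i.2)
  refine ⟨{
    d := Fin.cons (c * K * (K + 1)) (Fin.cons (c * (K + 1)) fun i : Fin (m + 1) => sylvesterSeq i)
    r := Fin.cons 1 (Fin.cons K fun i : Fin (m + 1) => (K + 1) * (c * K / sylvesterSeq i))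
    L := c * K * (K + 1)
    w := Fin.cons 0 (Fin.cons (-1) fun i : Fin (m + 1) => W i)
    r_pos := ?_
    L_pos := by positivity
    gcd_r := ?_
    r_mul_d := ?_
    sum_r := ?_
    sum_w := ?_
    dvd_w_mul_d := ?_
    exists_shift := ?_
    exists_generator := ⟨Fin.cons K (Fin.cons (-1) 0), ?_, ?_⟩ }⟩
  · refine Fin.cases one_pos (Fin.cases hKpos fun i => ?_)
    simp only [Fin.cons_succ]
    exact Nat.mul_pos K.succ_pos
      (Nat.div_pos (Nat.le_of_dvd hpos (hdvd i)) (sylvesterSeq_pos _))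
  · refine Nat.dvd_one.1 ?_
    exact Finset.gcd_dvd (Finset.mem_univ (0 : Fin (m + 3)))
  · refine Fin.cases (by simp) (Fin.cases ?_ fun i => ?_)
    · simp only [Fin.cons_succ, Fin.cons_zero]; ring
    · simp only [Fin.cons_succ]
      rw [mul_assoc, hdvd' i, mul_comm]
  · rw [Fin.sum_univ_succ, Fin.sum_univ_succ]
    simp only [Fin.cons_succ, Fin.cons_zero, ← Finset.mul_sum]
    nlinarith
  · rw [Fin.sum_univ_succ, Fin.sum_univ_succ]
    simp only [Fin.cons_succ, Fin.cons_zero]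
    rw [hW1]; norm_num
  · refine Fin.cases (by simp) (Fin.cases ?_ fun i => ?_)
    · simp only [Fin.cons_succ, Fin.cons_zero]
      exact ⟨-(K + 1), by push_cast; ring⟩
    · simp only [Fin.cons_succ]
      exact (Int.natCast_dvd_natCast.2 (dvd_mul_right c K)).trans (hWi i)
  · intro v hL hc
    rw [Fin.sum_univ_succ, Fin.sum_univ_succ] at hL hc
    simp only [Fin.cons_succ, Fin.cons_zero] at hL hc
    obtain ⟨q, hq⟩ := hc
    -- `-∑ W j * v j` solves the congruences modulo the Sylvester numbers, hence so does `s`;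
    -- the correction by a multiple of `c * K` settles the one modulo `c * (K + 1)`.
    let s : ℤ := -∑ j : Fin (m + 1), W j * v j.succ.succ - c * K * q
    have hs : ∀ i : Fin (m + 1), (sylvesterSeq i : ℤ) ∣ v i.succ.succ + s := by
      intro i
      have h1 : v i.succ.succ + s =
          -∑ j : Fin (m + 1), W j * (v j.succ.succ - v i.succ.succ) - c * K * q := by
        simp only [mul_sub, Finset.sum_sub_distrib, ← Finset.sum_mul, hW1, s]
        ring
      have hN' : (sylvesterSeq i : ℤ) ∣ c * K := by exact_mod_cast hdvd i
      rw [h1]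
      refine dvd_sub ((Finset.dvd_sum fun j _ => ?_).neg_right) (hN'.mul_right q)
      by_cases hij : i = j
      · simp [hij]
      · have hco : IsCoprime (sylvesterSeq i : ℤ) (sylvesterSeq j) :=
          Nat.isCoprime_iff_coprime.2 (coprime_sylvesterSeq fun h => hij (Fin.ext h))
        refine (hco.dvd_of_dvd_mul_right ?_).mul_right _
        exact (Int.natCast_dvd_natCast.2 (hdvd i)).trans (hWi j)
    have hb : ((c * (K + 1) : ℕ) : ℤ) ∣ v (Fin.succ 0) + s :=
      ⟨-q, by push_cast; simp only [s]; linarith⟩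
    refine ⟨s, Fin.cases ?_ (Fin.cases hb hs)⟩
    simp only [Fin.cons_zero]
    -- The numerators add up to `L`, so `∑ r i * (v i + s)` is again divisible by `L`; so is
    -- every summand but the one with numerator `1`.
    have hsum' : ∑ i : Fin (m + 1), ((c * K / sylvesterSeq i : ℕ) : ℤ) + 1 = c * K := by
      exact_mod_cast hsum
    obtain ⟨t, ht⟩ := hb
    choose y hy using hs
    obtain ⟨z, hz⟩ := hL
    refine ⟨z + s - t - ∑ i, y i, ?_⟩
    have hterm : ∀ i : Fin (m + 1),
        (((K + 1) * (c * K / sylvesterSeq i) : ℕ) : ℤ) * v i.succ.succ =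
          c * K * (K + 1) * y i - (K + 1) * s * ((c * K / sylvesterSeq i : ℕ) : ℤ) := by
      intro i
      have h2 : ((c * K / sylvesterSeq i : ℕ) : ℤ) * sylvesterSeq i = c * K := by
        exact_mod_cast hdvd' i
      rw [show v i.succ.succ = sylvesterSeq i * y i - s by linarith [hy i], Nat.cast_mul, mul_sub,
        ← h2]
      push_cast
      ring
    rw [Finset.sum_congr rfl fun i _ => hterm i, Finset.sum_sub_distrib, ← Finset.mul_sum,
      ← Finset.mul_sum, eq_sub_of_add_eq hsum', show v (Fin.succ 0) = c * (K + 1) * t - s by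
        push_cast at ht; linarith] at hz
    push_cast at hz ⊢
    linear_combination hz
  · rw [Fin.sum_univ_succ, Fin.sum_univ_succ]
    simp
  · rw [Fin.sum_univ_succ, Fin.sum_univ_succ]
    simp

/-- Every divisor of a product of initial Sylvester numbers is the order of a cyclic critical group
on a star and on the complete graph with as many vertices as the star has leaves. -/
theorem exists_cyclicCriticalGroup_of_dvd {m c : ℕ}
    (h : c ∣ ∏ i ∈ Finset.range (m + 1), sylvesterSeq i) :
    0 < c ∧ ∃ n : ℕ, 1 ≤ n ∧ IsCyclicCriticalGroup (starWithLeaves n) c ∧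
      IsCyclicCriticalGroup (⊤ : SimpleGraph (Fin n)) c := by
  have hc : 0 < c := Nat.pos_of_dvd_of_pos h (prod_sylvesterSeq_pos _)
  obtain ⟨K, hK⟩ := h
  obtain ⟨C⟩ := nonempty_sylvester_certificate m c K hK
  exact ⟨hc, m + 3, by omega, C.isCyclicCriticalGroup_star hc, C.isCyclicCriticalGroup_complete hc⟩

theorem strictMono_prod_sylvesterSeq :
    StrictMono fun m => ∏ i ∈ Finset.range (m + 1), sylvesterSeq i := by
  refine strictMono_nat_of_lt_succ fun m => ?_
  have h := prod_sylvesterSeq_add_one (m + 1)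
  have hpos := prod_sylvesterSeq_pos (m + 1)
  rw [Finset.prod_range_succ _ (m + 1), ← h]
  nlinarith

theorem exists_dvd_prod_sylvesterSeq (T : Finset ℕ) (hT : ∀ p ∈ T, IsSylvesterPrime p) :
    ∃ m, ∏ p ∈ T, p ∣ ∏ i ∈ Finset.range (m + 1), sylvesterSeq i := by
  choose! k hk using fun p hp => (hT p hp).2
  refine ⟨T.sup k, Finset.prod_primes_dvd _ (fun p hp => (hT p hp).1.prime) fun p hp => ?_⟩
  exact (hk p hp).trans (sylvesterSeq_dvd_prod (Nat.lt_succ_of_le (Finset.le_sup hp)))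

theorem proposition4p4 :
    (∀ T : Finset ℕ, (∀ p ∈ T, IsSylvesterPrime p) →
      ∃ n : ℕ, 1 ≤ n ∧
        IsCyclicCriticalGroup (starWithLeaves n) (∏ p ∈ T, p) ∧
        IsCyclicCriticalGroup (⊤ : SimpleGraph (Fin n)) (∏ p ∈ T, p)) ∧
    {c : ℕ | 0 < c ∧ ∃ n : ℕ, 1 ≤ n ∧
        IsCyclicCriticalGroup (starWithLeaves n) c ∧
        IsCyclicCriticalGroup (⊤ : SimpleGraph (Fin n)) c}.Infinite := by
  refine ⟨fun T hT => ?_, ?_⟩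
  · obtain ⟨m, hm⟩ := exists_dvd_prod_sylvesterSeq T hT
    exact (exists_cyclicCriticalGroup_of_dvd hm).2
  · exact Set.infinite_of_injective_forall_mem strictMono_prod_sylvesterSeq.injective
      fun m => exists_cyclicCriticalGroup_of_dvd (dvd_refl _)
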